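/- Let $X$ be a (real) Banach lattice and let $\mathcal S$ be an ideal irreducible, $\mathbb R_+$-closed semigroup of positive operators on $X$; that is, $\mathcal S$ is closed under composition, norm closed, closed under multiplication by positive scalars, and the only closed order ideals of $X$ invariant under every member of $\mathcal S$ are $\{0\}$ and $X$. Suppose that $\mathcal S$ contains a non-zero operator of finite rank. Let $r$ be the minimal rank of non-zero operators in $\mathcal S$, and let $\mathcal P_r$ be the set of all projections of rank $r$ in $\mathcal S$. For an operator $S$ leaving a finite-dimensional subspace $Y$ invariant, write $S_Y$ for the restriction of $S$ to $Y$ and $r(S_Y)$ for its spectral radius, i.e. the largest modulus of a complex eigenvalue of $S_Y$. (1) Suppose that $\mathcal P_r$ consists of a single projection $P$, and let $Y=\operatorname{Range}P$. Then for every non-zero $S\in\mathcal S$ the subspace $Y$ is $S$-invariant, $r(S_Y)>0$, and $$\liminf_{n\to\infty}\|S^nx\|^{1/n}\ge r(S_Y)\qquad\text{for every } x>0 \text{ in } X.$$ In particular, $S$ is strictly positive: $Sx>0$ whenever $x>0$. (2) Suppose that all projections in $\mathcal P_r$ have the same range $Y$. Then for every non-zero $S\in\mathcal S$ the subspace $Y$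 is $S$-invariant, $r(S_Y)>0$, and $$\liminf_{n\to\infty}\|S^{*n}x^*\|^{1/n}\ge r(S_Y)\qquad\text{for every } x^*>0 \text{ in } X^*.$$ In particular, $S^*$ is strictly positive: $S^*x^*>0$ whenever $x^*>0$. Here $x>0$ means $x\ge0$ and $x\ne0$, and similarly for functionals. -/

import Mathlib

open Filter
open scoped ENNReal TensorProduct

section OperatorSemigroups

variable {X : Type*} [NormedAddCommGroup X] [NormedSpace ℝ X]

/-- The minimal rank of the non-zero elements of a set of operators;
it is `⊤` if the set contains no non-zero operator of finite rank. -/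
noncomputable def minRank (A : Set (X →L[ℝ] X)) : ℕ∞ :=
  ⨅ T ∈ A, ⨅ _ : T ≠ 0, Cardinal.toENat (LinearMap.rank (T : X →ₗ[ℝ] X))

/-- The projections in `A` whose rank equals the minimal rank of `A`. -/
def minRankProjections (A : Set (X →L[ℝ] X)) : Set (X →L[ℝ] X) :=
  {P | P ∈ A ∧ IsIdempotentElem P ∧
    Cardinal.toENat (LinearMap.rank (P : X →ₗ[ℝ] X)) = minRank A}

/-- Norm closed and closed under multiplication by positive scalars. -/
def IsRPlusClosed (A : Set (X →L[ℝ] X)) : Prop :=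
  IsClosed A ∧ ∀ T ∈ A, ∀ c : ℝ, 0 < c → c • T ∈ A

/-- The (complex) spectral radius of an endomorphism of a real vector space: the spectral radius
of its complexification. -/
noncomputable def realSpectralRadius {Y : Type*} [AddCommGroup Y] [Module ℝ Y]
    (T : Y →ₗ[ℝ] Y) : ℝ≥0∞ :=
  spectralRadius ℂ (T.baseChange ℂ : Module.End ℂ (ℂ ⊗[ℝ] Y))

/-- The spectral radius of the restriction of `S` to an `S`-invariant subspace `Y`. -/
noncomputable def restrictSpectralRadius (S : X →L[ℝ] X) (Y : Submodule ℝ X)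
    (h : ∀ y ∈ Y, S y ∈ Y) : ℝ≥0∞ :=
  realSpectralRadius ((S : X →ₗ[ℝ] X).restrict h)

/-- The Banach space adjoint `S* : X* → X*`, `S* f = f ∘ S`. -/
noncomputable def banachAdjoint (S : X →L[ℝ] X) : StrongDual ℝ X →L[ℝ] StrongDual ℝ X :=
  ContinuousLinearMap.precomp ℝ S

section Order

variable [Lattice X]

/-- `T` maps the positive cone into itself. -/
def IsPositiveOperator (T : X →L[ℝ] X) : Prop := ∀ x, 0 ≤ x → 0 ≤ T x

/-- The only closed order ideals invariant under all members of `A` are `{0}` and `X`. -/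
def IsIdealIrreducible (A : Set (X →L[ℝ] X)) : Prop :=
  ∀ J : Submodule ℝ X, LatticeOrderedAddCommGroup.IsSolid (J : Set X) → IsClosed (J : Set X) →
    (∀ T ∈ A, ∀ x ∈ J, T x ∈ J) → J = ⊥ ∨ J = ⊤

/-- `f > 0` in the dual Banach lattice: `f` is non-negative on the positive cone and non-zero. -/
def IsPosFunctional (f : StrongDual ℝ X) : Prop := (∀ x, 0 ≤ x → 0 ≤ f x) ∧ f ≠ 0

end Order

end OperatorSemigroups

/-! ### Null ideals and ideal irreducibility. -/

section Irreducible

variable {X : Type*} [NormedAddCommGroup X] [NormedSpace ℝ X] [Lattice X]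

/-! Irreducibility enters through `IsIdealIrreducible.eq_zero_of_orbit`: a monotone operator killing
the orbit of one non-zero positive vector is zero.

Minimality of rank enters through invertibility. Let `T` have minimal rank, `Y` its range, and let
`S` in `𝒮` leave `Y` invariant. A non-zero limit `B` of positive multiples of powers of `S|Y` is
invertible, because `B ∘ T` is a non-zero member of `𝒮` with range inside `Y`, hence equal to `Y`.
Compactness of the unit sphere then gives `‖(S|Y)^n‖ ‖y‖ ≤ C ‖S^n y‖` on `Y`, so every non-zero
orbit in `Y` grows at the full rate. Moreover, if `L = T|Y` is non-zero, then `L⁻¹` is itself such a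
limit, so `L⁻¹ ∘ T` is a projection in `𝒮`. Combined with irreducibility, every minimal rank
operator shares its range with one minimal projection and its kernel with another.

Hence a common range `Y` forces `S Y = Y`, and a unique projection `P` also has an `S`-invariant
kernel, so it commutes with `S`. In (1), `P x ≠ 0` and `‖S^n P x‖ = ‖P S^n x‖ ≤ ‖P‖ ‖S^n x‖` carries
the growth over to `x`. In (2), `f y ≠ 0` for some `y` in `Y`; writing `y = S^n w` with `w` in `Y`,
the growth at `w` bounds `‖w‖` above, while `f y = (S*^n f) w`. -/

theorem apply_eq_zero_of_le {E : Type*} [NormedAddCommGroup E] [NormedSpace ℝ E] [PartialOrder E]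
    {F : X →L[ℝ] E} (hF : Monotone F) {x y : X} (hx : 0 ≤ x) (hxy : x ≤ y) (hy : F y = 0) :
    F x = 0 := by
  have h1 := hF hxy
  have h2 := hF hx
  rw [map_zero] at h2
  rw [hy] at h1
  exact le_antisymm h1 h2

theorem abs_smul_le_abs_smul_abs [IsOrderedModule ℝ X] (c : ℝ) (x : X) : |c • x| ≤ |c| • |x| := by
  have key : ∀ (d : ℝ) (y : X), 0 ≤ d → |d • y| ≤ d • |y| := fun d y hd => by
    refine abs_le'.2 ⟨smul_le_smul_of_nonneg_left (le_abs_self y) hd, ?_⟩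
    rw [← smul_neg]
    exact smul_le_smul_of_nonneg_left (neg_le_abs y) hd
  rcases le_total 0 c with hc | hc
  · rw [abs_of_nonneg hc]
    exact key c x hc
  · rw [abs_of_nonpos hc, ← neg_neg (c • x), ← neg_smul, abs_neg]
    exact key (-c) x (neg_nonneg.2 hc)

variable [IsOrderedAddMonoid X]

theorem IsPositiveOperator.monotone {T : X →L[ℝ] X} (h : IsPositiveOperator T) : Monotone T := by
  intro a b hab
  have := h (b - a) (sub_nonneg.2 hab)
  rwa [map_sub, sub_nonneg] at this

theorem IsPositiveOperator.abs_apply_le {T : X →L[ℝ] X} (h : IsPositiveOperator T) (x : X) :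
    |T x| ≤ T |x| := by
  refine abs_le'.2 ⟨h.monotone (le_abs_self x), ?_⟩
  rw [← map_neg]
  exact h.monotone (neg_le_abs x)

theorem IsPosFunctional.monotone {f : StrongDual ℝ X} (h : IsPosFunctional f) : Monotone f := by
  intro a b hab
  have := h.1 (b - a) (sub_nonneg.2 hab)
  rwa [map_sub, sub_nonneg] at this

theorem ContinuousLinearMap.ext_zero_of_nonneg {E : Type*} [NormedAddCommGroup E] [NormedSpace ℝ E]
    {F : X →L[ℝ] E} (h : ∀ x, 0 ≤ x → F x = 0) : F = 0 := by
  ext x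
  rw [← posPart_sub_negPart x, map_sub, h _ (posPart_nonneg x), h _ (negPart_nonneg x)]
  simp

theorem ContinuousLinearMap.exists_pos_apply_ne_zero {E : Type*} [NormedAddCommGroup E]
    [NormedSpace ℝ E] {F : X →L[ℝ] E} (h : F ≠ 0) : ∃ x, 0 ≤ x ∧ F x ≠ 0 := by
  by_contra! hc
  exact h (ContinuousLinearMap.ext_zero_of_nonneg hc)

variable [IsOrderedModule ℝ X]

/-- The null ideal of a family of monotone operators. -/
def nullIdeal {ι E : Type*} [NormedAddCommGroup E] [NormedSpace ℝ E] [PartialOrder E]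
    (F : ι → X →L[ℝ] E) (hF : ∀ i, Monotone (F i)) : Submodule ℝ X where
  carrier := {y | ∀ i, F i |y| = 0}
  zero_mem' := by simp
  add_mem' := by
    intro a b ha hb i
    have h1 := hF i (abs_add_le a b)
    have h2 := hF i (abs_nonneg (a + b))
    rw [map_add, ha, hb, add_zero] at h1
    rw [map_zero] at h2
    exact le_antisymm h1 h2
  smul_mem' := by
    intro c a ha i
    have h1 := hF i (abs_smul_le_abs_smul_abs c a)
    have h2 := hF i (abs_nonneg (c • a))
    rw [map_smul, ha, smul_zero] at h1
    rw [map_zero] at h2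
    exact le_antisymm h1 h2

variable {E : Type*} [NormedAddCommGroup E] [NormedSpace ℝ E] [PartialOrder E]

theorem mem_nullIdeal {ι : Type*} {F : ι → X →L[ℝ] E} {hF : ∀ i, Monotone (F i)} {y : X} :
    y ∈ nullIdeal F hF ↔ ∀ i, F i |y| = 0 := Iff.rfl

theorem nullIdeal_isSolid {ι : Type*} (F : ι → X →L[ℝ] E) (hF : ∀ i, Monotone (F i)) :
    LatticeOrderedAddCommGroup.IsSolid (nullIdeal F hF : Set X) :=
  fun _ hx _ hyx i => apply_eq_zero_of_le (hF i) (abs_nonneg _) hyx (hx i)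

variable [HasSolidNorm X]

theorem nullIdeal_isClosed {ι : Type*} (F : ι → X →L[ℝ] E) (hF : ∀ i, Monotone (F i)) :
    IsClosed (nullIdeal F hF : Set X) := by
  have : (nullIdeal F hF : Set X) = ⋂ i, {y | F i |y| = 0} := by
    ext y; simp [mem_nullIdeal]
  rw [this]
  refine isClosed_iInter fun i => isClosed_eq ((F i).continuous.comp ?_) continuous_const
  exact continuous_id.sup continuous_neg

/-- By `F |A x| ≤ F (A |x|) = 0`, every member of `𝒮` maps all of `X` into the null ideal of `F`,
which is therefore invariant. It is not `{0}`, since `T₀ ≠ 0`. -/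
theorem IsIdealIrreducible.eq_zero_of_forall_comp_eq_zero {𝒮 : Subsemigroup (X →L[ℝ] X)}
    (hpos : ∀ T ∈ 𝒮, IsPositiveOperator T) (hirr : IsIdealIrreducible (𝒮 : Set (X →L[ℝ] X)))
    {T₀ : X →L[ℝ] X} (hT₀ : T₀ ∈ 𝒮) (hne : T₀ ≠ 0) {F : X →L[ℝ] E} (hF : Monotone F)
    (h : ∀ A ∈ 𝒮, ∀ x, 0 ≤ x → F (A x) = 0) : F = 0 := by
  rcases hirr (nullIdeal (fun _ : Unit => F) fun _ => hF) (nullIdeal_isSolid _ _)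
    (nullIdeal_isClosed _ _) (fun T hT x _ _ => apply_eq_zero_of_le hF (abs_nonneg _)
      ((hpos T hT).abs_apply_le x) (h T hT _ (abs_nonneg x))) with hJ | hJ
  · refine absurd (ContinuousLinearMap.ext_zero_of_nonneg fun x hx => ?_) hne
    have : T₀ x ∈ nullIdeal (fun _ : Unit => F) fun _ => hF := fun _ => by
      rw [abs_of_nonneg (hpos T₀ hT₀ x hx)]
      exact h T₀ hT₀ x hx
    rwa [hJ, Submodule.mem_bot] at this
  · refine ContinuousLinearMap.ext_zero_of_nonneg fun x hx => ?_
    have : x ∈ nullIdeal (fun _ : Unit => F) fun _ => hF := hJ ▸ Submodule.mem_top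
    simpa [abs_of_nonneg hx] using this ()

/-- A monotone operator that vanishes on the orbit of a positive vector under an ideal irreducible
semigroup vanishes. -/
theorem IsIdealIrreducible.eq_zero_of_orbit {𝒮 : Subsemigroup (X →L[ℝ] X)}
    (hpos : ∀ T ∈ 𝒮, IsPositiveOperator T) (hirr : IsIdealIrreducible (𝒮 : Set (X →L[ℝ] X)))
    {T₀ : X →L[ℝ] X} (hT₀ : T₀ ∈ 𝒮) (hne : T₀ ≠ 0) {F : X →L[ℝ] E} (hF : Monotone F)
    {x : X} (hx : 0 ≤ x) (hx0 : x ≠ 0) (h : ∀ A ∈ 𝒮, F (A x) = 0) : F = 0 := by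
  -- The ideal used here is the common null ideal of all `F ∘ A`. As `𝒮` need not contain the
  -- identity, this yields only `F ∘ A = 0`, and the preceding lemma finishes.
  have hmono : ∀ A : 𝒮, Monotone (F ∘L (A : X →L[ℝ] X)) :=
    fun A => hF.comp (hpos A A.2).monotone
  refine hirr.eq_zero_of_forall_comp_eq_zero hpos hT₀ hne hF ?_
  rcases hirr (nullIdeal (fun A : 𝒮 => F ∘L (A : X →L[ℝ] X)) hmono) (nullIdeal_isSolid _ _)
    (nullIdeal_isClosed _ _) (fun T hT y hy A =>
      apply_eq_zero_of_le (hmono A) (abs_nonneg _) ((hpos T hT).abs_apply_le y)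
        (hy ⟨A * T, 𝒮.mul_mem A.2 hT⟩)) with hJ | hJ
  · have : x ∈ nullIdeal (fun A : 𝒮 => F ∘L (A : X →L[ℝ] X)) hmono := fun A => by
      rw [abs_of_nonneg hx]
      exact h A A.2
    rw [hJ, Submodule.mem_bot] at this
    exact absurd this hx0
  · intro A hA y hy
    have : y ∈ nullIdeal (fun A : 𝒮 => F ∘L (A : X →L[ℝ] X)) hmono := hJ ▸ Submodule.mem_top
    simpa [abs_of_nonneg hy] using this ⟨A, hA⟩

end Irreducible

/-! ### Powers of an operator in finite dimension. -/

section FiniteDimensional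

variable {V : Type*} [NormedAddCommGroup V] [NormedSpace ℝ V]

/-- The closed set of positive multiples of powers of `L`. -/
def closedRay (L : V →L[ℝ] V) : Set (V →L[ℝ] V) :=
  closure {B | ∃ (c : ℝ) (n : ℕ), 0 < c ∧ B = c • L ^ n}

theorem smul_pow_mem_closedRay (L : V →L[ℝ] V) {c : ℝ} (hc : 0 < c) (n : ℕ) :
    c • L ^ n ∈ closedRay L := subset_closure ⟨c, n, hc, rfl⟩

variable [FiniteDimensional ℝ V]

/-- Inversion is continuous, hence bounded, on the compact set of norm-one elements of the ray;
apply this to the normalized powers of `L`. -/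
theorem exists_bound_of_closedRay {L : V →L[ℝ] V}
    (h : ∀ B ∈ closedRay L, B ≠ 0 → IsUnit B) :
    ∃ C : ℝ, 0 < C ∧ ∀ n v, ‖L ^ n‖ * ‖v‖ ≤ C * ‖(L ^ n) v‖ := by
  have hK : IsCompact (closedRay L ∩ Metric.sphere 0 1) :=
    have : ProperSpace (V →L[ℝ] V) := FiniteDimensional.proper ℝ _
    (isCompact_sphere _ _).inter_left isClosed_closure
  have hu : ∀ B ∈ closedRay L ∩ Metric.sphere 0 1, IsUnit B := fun B hB =>
    h B hB.1 (by rintro rfl; simpa using hB.2)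
  have hcont : ContinuousOn (fun B : V →L[ℝ] V => Ring.inverse B)
      (closedRay L ∩ Metric.sphere 0 1) := by
    intro B hB
    have : CompleteSpace (V →L[ℝ] V) := FiniteDimensional.complete ℝ _
    obtain ⟨u, rfl⟩ := hu B hB
    exact (NormedRing.inverse_continuousAt u).continuousWithinAt
  obtain ⟨C, hC⟩ := hK.exists_bound_of_continuousOn hcont
  refine ⟨max C 1, by positivity, fun n v => ?_⟩
  by_cases h0 : L ^ n = 0
  · simp [h0]
  have hn : 0 < ‖L ^ n‖ := norm_pos_iff.2 h0
  set B := ‖L ^ n‖⁻¹ • L ^ n with hB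
  have hBK : B ∈ closedRay L ∩ Metric.sphere 0 1 := by
    refine ⟨smul_pow_mem_closedRay L (inv_pos.2 hn) n, ?_⟩
    rw [mem_sphere_zero_iff_norm, hB, norm_smul, norm_inv, norm_norm, inv_mul_cancel₀ hn.ne']
  have hv : v = Ring.inverse B (B v) := by
    rw [← ContinuousLinearMap.comp_apply, ← ContinuousLinearMap.mul_def, Ring.inverse_mul_cancel _ (hu B hBK)]; rfl
  have h1 : ‖v‖ ≤ max C 1 * ‖B v‖ := by
    conv_lhs => rw [hv]
    refine (ContinuousLinearMap.le_opNorm _ _).trans ?_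
    gcongr
    exact (hC B hBK).trans (le_max_left _ _)
  have h2 : ‖B v‖ = ‖L ^ n‖⁻¹ * ‖(L ^ n) v‖ := by
    rw [hB, smul_apply, norm_smul, norm_inv, norm_norm]
  rw [h2] at h1
  calc ‖L ^ n‖ * ‖v‖ ≤ ‖L ^ n‖ * (max C 1 * (‖L ^ n‖⁻¹ * ‖(L ^ n) v‖)) := by gcongr
    _ = max C 1 * ‖(L ^ n) v‖ := by field_simp

/-- Normalized powers converge along a subsequence to an invertible limit, so quotients of
consecutive terms tend to the identity. Such a quotient times `L⁻¹` is a positive multiple of a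
power of `L`. -/
theorem inverse_mem_closedRay [Nontrivial V] {L : V →L[ℝ] V} (hL : IsUnit L)
    (h : ∀ B ∈ closedRay L, B ≠ 0 → IsUnit B) : Ring.inverse L ∈ closedRay L := by
  have : ProperSpace (V →L[ℝ] V) := FiniteDimensional.proper ℝ _
  have : CompleteSpace (V →L[ℝ] V) := FiniteDimensional.complete ℝ _
  have hn : ∀ n, 0 < ‖L ^ n‖ := fun n => norm_pos_iff.2 (hL.pow n).ne_zero
  set b : ℕ → V →L[ℝ] V := fun n => ‖L ^ n‖⁻¹ • L ^ n with hb
  obtain ⟨B, hB, φ, hφ, hlim⟩ := (isCompact_sphere (0 : V →L[ℝ] V) 1).tendsto_subseq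
    (x := b) fun n => by
      rw [mem_sphere_zero_iff_norm, hb, norm_smul, norm_inv, norm_norm,
        inv_mul_cancel₀ (hn n).ne']
  have hBm : B ∈ closedRay L := isClosed_closure.mem_of_tendsto hlim
    (Eventually.of_forall fun k => smul_pow_mem_closedRay L (inv_pos.2 (hn _)) _)
  obtain ⟨u, rfl⟩ := h B hBm (by rintro rfl; simp at hB)
  have hinv : Tendsto (fun k => Ring.inverse (b (φ k))) atTop
      (nhds (Ring.inverse (u : V →L[ℝ] V))) :=
    (NormedRing.inverse_continuousAt u).tendsto.comp hlim
  have hlim' := (hinv.mul (hlim.comp (tendsto_add_atTop_nat 1))).mul_const (Ring.inverse L)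
  rw [Ring.inverse_mul_cancel _ u.isUnit, one_mul] at hlim'
  refine isClosed_closure.mem_of_tendsto hlim' (Eventually.of_forall fun k => ?_)
  -- `φ` is strictly increasing, so the exponent `m = φ (k + 1) - φ k - 1` is still a natural number
  -- after the factor `L⁻¹`.
  obtain ⟨m, hm⟩ := Nat.exists_eq_add_of_lt (hφ (Nat.lt_succ_self k))
  refine subset_closure ⟨‖L ^ φ k‖ * ‖L ^ φ (k + 1)‖⁻¹, m, mul_pos (hn _) (inv_pos.2 (hn _)), ?_⟩
  obtain ⟨w, rfl⟩ := hL
  have h1 : Ring.inverse (b (φ k)) =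
      ‖(w : V →L[ℝ] V) ^ φ k‖ • ((w⁻¹ ^ φ k : (V →L[ℝ] V)ˣ) : V →L[ℝ] V) := by
    have hmul : b (φ k) * (‖(w : V →L[ℝ] V) ^ φ k‖ • ((w⁻¹ ^ φ k : (V →L[ℝ] V)ˣ) : V →L[ℝ] V)) =
        1 := by
      simp only [hb, smul_mul_assoc, mul_smul_comm, smul_smul]
      rw [mul_inv_cancel₀ (hn _).ne', one_smul, ← Units.val_pow_eq_pow_val, ← Units.val_mul,
        inv_pow, mul_inv_cancel, Units.val_one]
    have hbu : IsUnit (b (φ k)) := h _ (smul_pow_mem_closedRay _ (inv_pos.2 (hn _)) _)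
      (smul_ne_zero (inv_pos.2 (hn _)).ne' (norm_pos_iff.1 (hn _)))
    rw [← mul_one (Ring.inverse _), ← hmul, ← mul_assoc, Ring.inverse_mul_cancel _ hbu, one_mul]
  simp only [Function.comp]
  rw [h1, Ring.inverse_unit]
  simp only [hb, smul_mul_assoc, mul_smul_comm, smul_smul]
  rw [mul_comm]
  congr 1
  rw [← Units.val_pow_eq_pow_val, ← Units.val_pow_eq_pow_val, ← Units.val_mul, ← Units.val_mul]
  congr 1
  rw [Nat.succ_eq_add_one] at hm
  rw [hm, pow_succ, pow_add]
  group

/-- Powers of an eigenvalue of the complexification are dominated by the norms of the powers. -/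
theorem exists_norm_pow_le_of_mem_spectrum (L : V →L[ℝ] V) {z : ℂ}
    (hz : z ∈ spectrum ℂ ((L : V →ₗ[ℝ] V).baseChange ℂ : Module.End ℂ (ℂ ⊗[ℝ] V))) :
    ∃ C : ℝ, 0 < C ∧ ∀ n, ‖z‖ ^ n ≤ C * ‖L ^ n‖ := by
  rw [← Module.End.hasEigenvalue_iff_mem_spectrum] at hz
  obtain ⟨v, hv⟩ := hz.exists_hasEigenvector
  have hpow : ∀ n, ((L ^ n : V →L[ℝ] V) : V →ₗ[ℝ] V).baseChange ℂ v = z ^ n • v := fun n => by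
    rw [← hv.pow_apply n, ContinuousLinearMap.toLinearMap_pow, LinearMap.baseChange_pow]
  let b := Module.finBasis ℝ V
  let b' := Algebra.TensorProduct.basis ℂ b
  -- One non-zero coordinate of the eigenvector suffices: that coordinate of `L ^ n` applied to `v`
  -- is multiplied by `z ^ n`, and it is bounded linearly in the operator norm.
  obtain ⟨j, hj⟩ : ∃ j, b'.repr v j ≠ 0 := by
    by_contra! hc
    exact hv.2 (b'.ext_elem (by simpa using hc))
  have hbound : ∀ w : ℂ ⊗[ℝ] V, ∃ C : ℝ, 0 ≤ C ∧
      ∀ A : V →L[ℝ] V, ‖b'.repr ((A : V →ₗ[ℝ] V).baseChange ℂ w) j‖ ≤ C * ‖A‖ := by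
    intro w
    induction w with
    | zero => exact ⟨0, le_rfl, by simp⟩
    | tmul a y =>
      let f : V →L[ℝ] ℝ := LinearMap.toContinuousLinearMap (b.coord j)
      refine ⟨‖a‖ * (‖f‖ * ‖y‖), by positivity, fun A => ?_⟩
      have : b'.repr ((A : V →ₗ[ℝ] V).baseChange ℂ (a ⊗ₜ y)) j = a * (f (A y) : ℝ) := by
        rw [LinearMap.baseChange_tmul, Algebra.TensorProduct.basis_repr_tmul]
        simp [f]
      rw [this, norm_mul, Complex.norm_real, mul_assoc]
      gcongr
      calc ‖f (A y)‖ ≤ ‖f‖ * (‖A‖ * ‖y‖) := by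
            refine (f.le_opNorm _).trans ?_
            gcongr
            exact A.le_opNorm y
        _ = _ := by ring
    | add w₁ w₂ h₁ h₂ =>
      obtain ⟨C₁, hC₁, h₁⟩ := h₁
      obtain ⟨C₂, hC₂, h₂⟩ := h₂
      refine ⟨C₁ + C₂, by positivity, fun A => ?_⟩
      rw [map_add, map_add, Finsupp.add_apply, add_mul]
      exact (norm_add_le _ _).trans (add_le_add (h₁ A) (h₂ A))
  obtain ⟨C, hC, h⟩ := hbound v
  have hj' : 0 < ‖b'.repr v j‖ := norm_pos_iff.2 hj
  refine ⟨(C + 1) / ‖b'.repr v j‖, by positivity, fun n => ?_⟩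
  have h1 := h (L ^ n)
  rw [hpow, map_smul, Finsupp.smul_apply, norm_smul, norm_pow] at h1
  rw [div_mul_eq_mul_div, le_div_iff₀ hj']
  refine h1.trans ?_
  gcongr
  linarith

theorem realSpectralRadius_pos {W : Type*} [AddCommGroup W] [Module ℝ W] [FiniteDimensional ℝ W]
    [Nontrivial W] {L : W →ₗ[ℝ] W} (hL : IsUnit L) : 0 < realSpectralRadius L := by
  have : Nontrivial (ℂ ⊗[ℝ] W) := by
    apply Module.nontrivial_of_finrank_pos (R := ℂ)
    rw [Module.finrank_baseChange]
    exact Module.finrank_pos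
  obtain ⟨z, hz⟩ := Module.End.exists_eigenvalue (L.baseChange ℂ : Module.End ℂ (ℂ ⊗[ℝ] W))
  rw [Module.End.hasEigenvalue_iff_mem_spectrum] at hz
  have hu : IsUnit (L.baseChange ℂ : Module.End ℂ (ℂ ⊗[ℝ] W)) :=
    hL.map (Module.End.baseChangeHom ℝ ℂ W)
  have hz0 : z ≠ 0 := by
    rintro rfl
    exact (spectrum.zero_notMem_iff ℂ).2 hu hz
  exact lt_of_lt_of_le (by simpa using hz0)
    (le_iSup₂ (f := fun k (_ : k ∈ spectrum ℂ (L.baseChange ℂ : Module.End ℂ (ℂ ⊗[ℝ] W))) =>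
      (‖k‖₊ : ℝ≥0∞)) z hz)

end FiniteDimensional

/-! ### Passing to `n`-th roots. -/

theorem ENNReal.le_liminf_of_mul_pow_le {u : ℕ → ℝ} {a c : ℝ} (hc : 0 < c) (ha : 0 ≤ a)
    (h : ∀ n, c * a ^ n ≤ u n) :
    ENNReal.ofReal a ≤ liminf (fun n : ℕ => ENNReal.ofReal (u n) ^ (1 / (n : ℝ))) atTop := by
  have hlim : Tendsto (fun n : ℕ => ENNReal.ofReal (c ^ (1 / (n : ℝ)) * a)) atTop
      (nhds (ENNReal.ofReal a)) := by
    refine ENNReal.tendsto_ofReal ?_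
    have : Tendsto (fun n : ℕ => c ^ (1 / (n : ℝ))) atTop (nhds (c ^ (0 : ℝ))) :=
      tendsto_const_nhds.rpow tendsto_one_div_atTop_nhds_zero_nat (Or.inl hc.ne')
    simpa using this.mul_const a
  rw [← hlim.liminf_eq]
  refine liminf_le_liminf ?_
  filter_upwards [eventually_gt_atTop 0] with n hn
  have hn' : (n : ℝ) ≠ 0 := by exact_mod_cast hn.ne'
  rw [ENNReal.ofReal_rpow_of_nonneg ((by positivity : 0 ≤ c * a ^ n).trans (h n)) (by positivity)]
  refine ENNReal.ofReal_le_ofReal ?_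
  calc c ^ (1 / (n : ℝ)) * a = (c * a ^ n) ^ (1 / (n : ℝ)) := by
        rw [Real.mul_rpow hc.le (by positivity), ← Real.rpow_natCast a n, ← Real.rpow_mul ha,
          mul_one_div_cancel hn', Real.rpow_one]
    _ ≤ _ := Real.rpow_le_rpow (by positivity) (h n) (by positivity)

/-! ### Operators of minimal rank and the projections they generate. -/

section MinimalRank

variable {X : Type*} [NormedAddCommGroup X] [NormedSpace ℝ X]

/-- A non-zero element of minimal rank. -/
structure IsMinRank (A : Set (X →L[ℝ] X)) (T : X →L[ℝ] X) : Prop where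
  mem : T ∈ A
  ne_zero : T ≠ 0
  rank_eq : Cardinal.toENat (LinearMap.rank (T : X →ₗ[ℝ] X)) = minRank A

theorem minRank_le {A : Set (X →L[ℝ] X)} {T : X →L[ℝ] X} (hT : T ∈ A) (h0 : T ≠ 0) :
    minRank A ≤ Cardinal.toENat (LinearMap.rank (T : X →ₗ[ℝ] X)) :=
  (iInf₂_le T hT).trans (iInf_le _ h0)

theorem exists_isMinRank {A : Set (X →L[ℝ] X)} (hA : minRank A < ⊤) : ∃ T, IsMinRank A T := by
  by_contra! hc
  have h : minRank A + 1 ≤ minRank A := by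
    conv_rhs => rw [minRank]
    refine le_iInf₂ fun T hT => le_iInf fun h0 => Order.add_one_le_of_lt ?_
    exact lt_of_le_of_ne (minRank_le hT h0) fun h => hc T ⟨hT, h0, h.symm⟩
  exact absurd ((ENat.add_one_le_iff hA.ne).1 h) (lt_irrefl _)

namespace IsMinRank

variable {A : Set (X →L[ℝ] X)} {T M : X →L[ℝ] X}

theorem rank_lt (hT : IsMinRank A T) (hA : minRank A < ⊤) :
    LinearMap.rank (T : X →ₗ[ℝ] X) < Cardinal.aleph0 := by
  rwa [← Cardinal.toENat_lt_top, hT.rank_eq]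

theorem finiteDimensional (hT : IsMinRank A T) (hA : minRank A < ⊤) :
    FiniteDimensional ℝ (LinearMap.range (T : X →ₗ[ℝ] X)) :=
  Module.rank_lt_aleph0_iff.1 (hT.rank_lt hA)

theorem of_rank_le (hT : IsMinRank A T) (hM : M ∈ A) (h0 : M ≠ 0)
    (h : LinearMap.rank (M : X →ₗ[ℝ] X) ≤ LinearMap.rank (T : X →ₗ[ℝ] X)) : IsMinRank A M :=
  ⟨hM, h0, le_antisymm ((OrderHomClass.mono Cardinal.toENat h).trans hT.rank_eq.le)
    (minRank_le hM h0)⟩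

theorem rank_eq_rank (hT : IsMinRank A T) (hM : IsMinRank A M) (hA : minRank A < ⊤) :
    LinearMap.rank (M : X →ₗ[ℝ] X) = LinearMap.rank (T : X →ₗ[ℝ] X) := by
  refine Cardinal.toENat_injOn (hM.rank_lt hA).le (hT.rank_lt hA).le ?_
  rw [hM.rank_eq, hT.rank_eq]

theorem finrank_eq (hT : IsMinRank A T) (hM : IsMinRank A M) (hA : minRank A < ⊤) :
    Module.finrank ℝ (LinearMap.range (M : X →ₗ[ℝ] X)) =
      Module.finrank ℝ (LinearMap.range (T : X →ₗ[ℝ] X)) :=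
  congrArg Cardinal.toNat (rank_eq_rank hT hM hA)

theorem range_eq_of_le (hT : IsMinRank A T) (hM : IsMinRank A M) (hA : minRank A < ⊤)
    (h : LinearMap.range (M : X →ₗ[ℝ] X) ≤ LinearMap.range (T : X →ₗ[ℝ] X)) :
    LinearMap.range (M : X →ₗ[ℝ] X) = LinearMap.range (T : X →ₗ[ℝ] X) :=
  have := hT.finiteDimensional hA
  Submodule.eq_of_le_of_finrank_eq h (hT.finrank_eq hM hA)

theorem of_range_le (hT : IsMinRank A T) (hM : M ∈ A) (h0 : M ≠ 0)
    (h : LinearMap.range (M : X →ₗ[ℝ] X) ≤ LinearMap.range (T : X →ₗ[ℝ] X)) : IsMinRank A M :=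
  hT.of_rank_le hM h0 (Submodule.rank_mono h)

theorem mul_right (hT : IsMinRank A T) (hM : T * M ∈ A) (h0 : T * M ≠ 0) : IsMinRank A (T * M) :=
  hT.of_range_le hM h0 (LinearMap.range_comp_le_range (M : X →ₗ[ℝ] X) (T : X →ₗ[ℝ] X))

theorem range_mul (hT : IsMinRank A T) (hA : minRank A < ⊤) (hM : T * M ∈ A) (h0 : T * M ≠ 0) :
    LinearMap.range ((T * M : X →L[ℝ] X) : X →ₗ[ℝ] X) = LinearMap.range (T : X →ₗ[ℝ] X) :=
  hT.range_eq_of_le (hT.mul_right hM h0) hA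
    (LinearMap.range_comp_le_range (M : X →ₗ[ℝ] X) (T : X →ₗ[ℝ] X))

theorem mul_left (hT : IsMinRank A T) (hM : M * T ∈ A) (h0 : M * T ≠ 0) : IsMinRank A (M * T) :=
  hT.of_rank_le hM h0 (LinearMap.rank_comp_le_right (T : X →ₗ[ℝ] X) (M : X →ₗ[ℝ] X))

/-- `M * T` again has minimal rank, so by rank-nullity `M` is injective on the range of `T`. -/
theorem apply_eq_zero_of_mul_left (hT : IsMinRank A T) (hA : minRank A < ⊤) (hM : M * T ∈ A)
    (h0 : M * T ≠ 0) {x : X} (hx : M (T x) = 0) : T x = 0 := by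
  have := hT.finiteDimensional hA
  let f := (M : X →ₗ[ℝ] X).domRestrict (LinearMap.range (T : X →ₗ[ℝ] X))
  have hr : LinearMap.range f = LinearMap.range ((M * T : X →L[ℝ] X) : X →ₗ[ℝ] X) := by
    ext y
    simp [f]
  have h1 := f.finrank_range_add_finrank_ker
  rw [hr, hT.finrank_eq (hT.mul_left hM h0) hA] at h1
  have h2 : LinearMap.ker f = ⊥ := Submodule.finrank_eq_zero.1 (by omega)
  have h3 : (⟨T x, LinearMap.mem_range_self (T : X →ₗ[ℝ] X) x⟩ :
      LinearMap.range (T : X →ₗ[ℝ] X)) ∈ LinearMap.ker f := hx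
  rw [h2, Submodule.mem_bot] at h3
  exact congrArg Subtype.val h3

end IsMinRank

/-- `T` as a map onto its range. -/
noncomputable def corestrict (T : X →L[ℝ] X) : X →L[ℝ] LinearMap.range (T : X →ₗ[ℝ] X) :=
  T.codRestrict _ fun x => LinearMap.mem_range_self (T : X →ₗ[ℝ] X) x

theorem corestrict_surjective (T : X →L[ℝ] X) : Function.Surjective (corestrict T) := by
  rintro ⟨_, x, rfl⟩
  exact ⟨x, rfl⟩

/-- The restriction of `S` to an invariant subspace. -/
noncomputable def restrictCLM (S : X →L[ℝ] X) (Y : Submodule ℝ X) (h : ∀ y ∈ Y, S y ∈ Y) :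
    Y →L[ℝ] Y :=
  (S ∘L Y.subtypeL).codRestrict Y fun y => h y y.2

theorem coe_restrictCLM_pow_apply (S : X →L[ℝ] X) (Y : Submodule ℝ X) (h : ∀ y ∈ Y, S y ∈ Y)
    (n : ℕ) (y : Y) : ((restrictCLM S Y h ^ n) y : X) = (S ^ n) y := by
  induction n generalizing y with
  | zero => rfl
  | succ n ih =>
    rw [pow_succ, pow_succ]
    exact ih _

/-- The operator on `X` obtained from an operator on the range of `T` by composing with `T`. -/
noncomputable def liftRange (T : X →L[ℝ] X)
    (B : LinearMap.range (T : X →ₗ[ℝ] X) →L[ℝ] LinearMap.range (T : X →ₗ[ℝ] X)) : X →L[ℝ] X :=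
  (LinearMap.range (T : X →ₗ[ℝ] X)).subtypeL ∘L B ∘L corestrict T

theorem continuous_liftRange (T : X →L[ℝ] X) : Continuous (liftRange T) :=
  continuous_const.clm_comp (continuous_id.clm_comp continuous_const)

theorem liftRange_apply (T : X →L[ℝ] X)
    (B : LinearMap.range (T : X →ₗ[ℝ] X) →L[ℝ] LinearMap.range (T : X →ₗ[ℝ] X)) (x : X) :
    liftRange T B x = B (corestrict T x) := rfl

theorem range_liftRange_le (T : X →L[ℝ] X)
    (B : LinearMap.range (T : X →ₗ[ℝ] X) →L[ℝ] LinearMap.range (T : X →ₗ[ℝ] X)) :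
    LinearMap.range (liftRange T B : X →ₗ[ℝ] X) ≤ LinearMap.range (T : X →ₗ[ℝ] X) := by
  rintro _ ⟨x, rfl⟩
  exact (B (corestrict T x)).2

theorem liftRange_ne_zero {T : X →L[ℝ] X}
    {B : LinearMap.range (T : X →ₗ[ℝ] X) →L[ℝ] LinearMap.range (T : X →ₗ[ℝ] X)} (hB : B ≠ 0) :
    liftRange T B ≠ 0 := by
  intro h
  refine hB (ContinuousLinearMap.ext fun y => ?_)
  obtain ⟨x, rfl⟩ := corestrict_surjective T y
  exact Subtype.ext (DFunLike.congr_fun h x)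

variable {𝒮 : Subsemigroup (X →L[ℝ] X)}

/-- Minimality leaves no room for a smaller non-zero range, so `B` is onto, hence bijective in
finite dimension. -/
theorem IsMinRank.isUnit_of_liftRange_mem {T : X →L[ℝ] X}
    (hT : IsMinRank (𝒮 : Set (X →L[ℝ] X)) T) (hrank : minRank (𝒮 : Set (X →L[ℝ] X)) < ⊤)
    {B : LinearMap.range (T : X →ₗ[ℝ] X) →L[ℝ] LinearMap.range (T : X →ₗ[ℝ] X)}
    (hB : B ≠ 0) (hmem : liftRange T B ∈ 𝒮) : IsUnit B := by
  have := hT.finiteDimensional hrank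
  have hM := hT.of_range_le hmem (liftRange_ne_zero hB) (range_liftRange_le T B)
  have hr := hT.range_eq_of_le hM hrank (range_liftRange_le T B)
  have hsurj : Function.Surjective B.toLinearMap := by
    intro y
    obtain ⟨x, hx⟩ := hr.ge y.2
    exact ⟨corestrict T x, Subtype.ext hx⟩
  have : CompleteSpace (LinearMap.range (T : X →ₗ[ℝ] X)) := FiniteDimensional.complete ℝ _
  rw [ContinuousLinearMap.isUnit_iff_bijective]
  exact ⟨LinearMap.injective_iff_surjective.2 hsurj, hsurj⟩

theorem pow_mul_mem {S T : X →L[ℝ] X} (hS : S ∈ 𝒮) (hT : T ∈ 𝒮) (n : ℕ) : S ^ n * T ∈ 𝒮 := by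
  induction n with
  | zero => simpa using hT
  | succ n ih =>
    rw [pow_succ', mul_assoc]
    exact 𝒮.mul_mem hS ih

theorem liftRange_mem_of_mem_closedRay (hclosed : IsRPlusClosed (𝒮 : Set (X →L[ℝ] X)))
    {S T : X →L[ℝ] X} (hS : S ∈ 𝒮) (hT : T ∈ 𝒮)
    (h : ∀ y ∈ LinearMap.range (T : X →ₗ[ℝ] X), S y ∈ LinearMap.range (T : X →ₗ[ℝ] X))
    {B : LinearMap.range (T : X →ₗ[ℝ] X) →L[ℝ] LinearMap.range (T : X →ₗ[ℝ] X)}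
    (hB : B ∈ closedRay (restrictCLM S _ h)) : liftRange T B ∈ 𝒮 := by
  refine closure_minimal (t := liftRange T ⁻¹' (𝒮 : Set (X →L[ℝ] X))) ?_
    (hclosed.1.preimage (continuous_liftRange T)) hB
  rintro _ ⟨c, n, hc, rfl⟩
  have : liftRange T (c • restrictCLM S _ h ^ n) = c • (S ^ n * T) := by
    ext x
    rw [liftRange_apply, smul_apply, Submodule.coe_smul, coe_restrictCLM_pow_apply]
    rfl
  rw [Set.mem_preimage, this]
  exact hclosed.2 _ (pow_mul_mem hS hT n) c hc

theorem IsMinRank.isUnit_of_mem_closedRay (hclosed : IsRPlusClosed (𝒮 : Set (X →L[ℝ] X)))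
    (hrank : minRank (𝒮 : Set (X →L[ℝ] X)) < ⊤) {S T : X →L[ℝ] X} (hS : S ∈ 𝒮)
    (hT : IsMinRank (𝒮 : Set (X →L[ℝ] X)) T)
    (h : ∀ y ∈ LinearMap.range (T : X →ₗ[ℝ] X), S y ∈ LinearMap.range (T : X →ₗ[ℝ] X)) :
    ∀ B ∈ closedRay (restrictCLM S _ h), B ≠ 0 → IsUnit B := fun _ hB h0 =>
  hT.isUnit_of_liftRange_mem hrank h0 (liftRange_mem_of_mem_closedRay hclosed hS hT.mem h hB)

theorem IsMinRank.nontrivial_range {A : Set (X →L[ℝ] X)} {T : X →L[ℝ] X} (hT : IsMinRank A T) :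
    Nontrivial (LinearMap.range (T : X →ₗ[ℝ] X)) := by
  rw [Submodule.nontrivial_iff_ne_bot, Ne, LinearMap.range_eq_bot]
  intro h
  exact hT.ne_zero (ContinuousLinearMap.ext fun x => DFunLike.congr_fun h x)

/-- A minimal rank operator whose square is non-zero yields a projection with the same range and
the same kernel. -/
theorem IsMinRank.exists_projection (hclosed : IsRPlusClosed (𝒮 : Set (X →L[ℝ] X)))
    (hrank : minRank (𝒮 : Set (X →L[ℝ] X)) < ⊤) {T : X →L[ℝ] X}
    (hT : IsMinRank (𝒮 : Set (X →L[ℝ] X)) T) (hTT : T * T ≠ 0) :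
    ∃ P ∈ minRankProjections (𝒮 : Set (X →L[ℝ] X)),
      LinearMap.range (P : X →ₗ[ℝ] X) = LinearMap.range (T : X →ₗ[ℝ] X) ∧
      ∀ x, P x = 0 ↔ T x = 0 := by
  have := hT.finiteDimensional hrank
  have := hT.nontrivial_range
  have hinv : ∀ y ∈ LinearMap.range (T : X →ₗ[ℝ] X), T y ∈ LinearMap.range (T : X →ₗ[ℝ] X) :=
    fun y _ => LinearMap.mem_range_self (T : X →ₗ[ℝ] X) y
  set L := restrictCLM T _ hinv with hL
  have hunits := hT.isUnit_of_mem_closedRay hclosed hrank hT.mem hinv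
  have hL0 : L ≠ 0 := fun h => hTT (ContinuousLinearMap.ext fun x =>
    congrArg Subtype.val (DFunLike.congr_fun h (corestrict T x)))
  have hLu : IsUnit L := hunits L (by simpa using smul_pow_mem_closedRay L one_pos 1) hL0
  have hcancel : ∀ y, Ring.inverse L (L y) = y := fun y =>
    DFunLike.congr_fun (Ring.inverse_mul_cancel L hLu) y
  have hcancel' : ∀ y, L (Ring.inverse L y) = y := fun y =>
    DFunLike.congr_fun (Ring.mul_inverse_cancel L hLu) y
  -- The projection is `L⁻¹ ∘ T`: since `T` acts as `L` on its range, this is the identity there.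
  have hmem := liftRange_mem_of_mem_closedRay hclosed hT.mem hT.mem hinv
    (inverse_mem_closedRay hLu hunits)
  have hP0 : Ring.inverse L ≠ 0 := fun h => by
    obtain ⟨y, hy⟩ := exists_ne (0 : LinearMap.range (T : X →ₗ[ℝ] X))
    apply hy
    rw [← hcancel y, h]
    rfl
  have hP := hT.of_range_le hmem (liftRange_ne_zero hP0) (range_liftRange_le T _)
  refine ⟨_, ⟨hmem, ?_, hP.rank_eq⟩, hT.range_eq_of_le hP hrank (range_liftRange_le T _), ?_⟩
  · ext x
    change ((Ring.inverse L (L (Ring.inverse L (corestrict T x))) :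
      LinearMap.range (T : X →ₗ[ℝ] X)) : X) = Ring.inverse L (corestrict T x)
    rw [hcancel]
  · intro x
    rw [liftRange_apply, Submodule.coe_eq_zero]
    constructor
    · intro h
      have h1 := hcancel' (corestrict T x)
      rw [h, map_zero] at h1
      exact (congrArg Subtype.val h1).symm
    · intro h
      have h1 : corestrict T x = 0 := Subtype.ext h
      rw [h1, map_zero]

/-- Orbits in a minimal invariant range grow at least as fast as the powers of any eigenvalue. -/
theorem IsMinRank.exists_growth (hclosed : IsRPlusClosed (𝒮 : Set (X →L[ℝ] X)))
    (hrank : minRank (𝒮 : Set (X →L[ℝ] X)) < ⊤) {S T : X →L[ℝ] X} (hS : S ∈ 𝒮)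
    (hT : IsMinRank (𝒮 : Set (X →L[ℝ] X)) T)
    (h : ∀ y ∈ LinearMap.range (T : X →ₗ[ℝ] X), S y ∈ LinearMap.range (T : X →ₗ[ℝ] X)) {z : ℂ}
    (hz : z ∈ spectrum ℂ (((S : X →ₗ[ℝ] X).restrict h).baseChange ℂ :
      Module.End ℂ (ℂ ⊗[ℝ] LinearMap.range (T : X →ₗ[ℝ] X)))) :
    ∃ c : ℝ, 0 < c ∧ ∀ n : ℕ, ∀ y ∈ LinearMap.range (T : X →ₗ[ℝ] X),
      c * ‖z‖ ^ n * ‖y‖ ≤ ‖(S ^ n) y‖ := by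
  have := hT.finiteDimensional hrank
  obtain ⟨C₁, hC₁, h₁⟩ := exists_norm_pow_le_of_mem_spectrum (restrictCLM S _ h) hz
  obtain ⟨C₂, hC₂, h₂⟩ := exists_bound_of_closedRay
    (hT.isUnit_of_mem_closedRay hclosed hrank hS h)
  refine ⟨(C₁ * C₂)⁻¹, by positivity, fun n y hy => ?_⟩
  have h3 := h₂ n ⟨y, hy⟩
  rw [Submodule.coe_norm, Submodule.coe_norm, coe_restrictCLM_pow_apply] at h3
  rw [mul_assoc, inv_mul_le_iff₀ (by positivity)]
  calc ‖z‖ ^ n * ‖y‖ ≤ C₁ * ‖restrictCLM S _ h ^ n‖ * ‖y‖ := by gcongr; exact h₁ n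
    _ = C₁ * (‖restrictCLM S _ h ^ n‖ * ‖y‖) := by ring
    _ ≤ C₁ * (C₂ * ‖(S ^ n) y‖) := by gcongr
    _ = _ := by ring

theorem banachAdjoint_pow_apply (S : X →L[ℝ] X) (n : ℕ) (f : StrongDual ℝ X) (x : X) :
    (banachAdjoint S ^ n) f x = f ((S ^ n) x) := by
  induction n generalizing f with
  | zero => rfl
  | succ n ih =>
    rw [pow_succ, pow_succ']
    exact ih _

/-- The operator `T` serves to show that the minimal rank is not zero, which excludes `P = 0`. -/
theorem IsMinRank.of_mem_minRankProjections {A : Set (X →L[ℝ] X)} {P T : X →L[ℝ] X}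
    (hT : IsMinRank A T) (hP : P ∈ minRankProjections A) : IsMinRank A P := by
  refine ⟨hP.1, ?_, hP.2.2⟩
  rintro rfl
  have h := hT.rank_eq.trans hP.2.2.symm
  rw [ContinuousLinearMap.toLinearMap_zero, LinearMap.rank_zero, map_zero,
    Cardinal.toENat_eq_zero] at h
  have := hT.nontrivial_range
  exact (rank_pos_iff_nontrivial (R := ℝ)).2 this |>.ne' h

theorem restrictSpectralRadius_pos {S P : X →L[ℝ] X}
    (hrank : minRank (𝒮 : Set (X →L[ℝ] X)) < ⊤) (hP : IsMinRank (𝒮 : Set (X →L[ℝ] X)) P)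
    (hr : LinearMap.range ((S * P : X →L[ℝ] X) : X →ₗ[ℝ] X) = LinearMap.range (P : X →ₗ[ℝ] X))
    (h : ∀ y ∈ LinearMap.range (P : X →ₗ[ℝ] X), S y ∈ LinearMap.range (P : X →ₗ[ℝ] X)) :
    0 < restrictSpectralRadius S (LinearMap.range (P : X →ₗ[ℝ] X)) h := by
  have := hP.finiteDimensional hrank
  have := hP.nontrivial_range
  refine realSpectralRadius_pos ?_
  rw [LinearMap.isUnit_iff_range_eq_top, LinearMap.range_eq_top]
  intro y
  obtain ⟨x, hx⟩ := hr.ge y.2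
  exact ⟨⟨P x, LinearMap.mem_range_self _ x⟩, Subtype.ext hx⟩

theorem surjOn_pow_of_range_eq {S P : X →L[ℝ] X}
    (hr : LinearMap.range ((S * P : X →L[ℝ] X) : X →ₗ[ℝ] X) = LinearMap.range (P : X →ₗ[ℝ] X))
    (n : ℕ) : ∀ y ∈ LinearMap.range (P : X →ₗ[ℝ] X),
      ∃ w ∈ LinearMap.range (P : X →ₗ[ℝ] X), (S ^ n) w = y := by
  induction n with
  | zero => exact fun y hy => ⟨y, hy, rfl⟩
  | succ n ih =>
    intro y hy
    obtain ⟨w, hw, rfl⟩ := ih y hy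
    obtain ⟨x, rfl⟩ := hr.ge hw
    refine ⟨P x, LinearMap.mem_range_self _ x, ?_⟩
    rw [pow_succ]
    rfl

/-- The spectral radius is a supremum over eigenvalues, so the constant may depend on `z`. -/
theorem restrictSpectralRadius_le_liminf {S : X →L[ℝ] X} {Y : Submodule ℝ X}
    (h : ∀ y ∈ Y, S y ∈ Y) {E : Type*} [NormedAddCommGroup E] {u : ℕ → E}
    (hu : ∀ z ∈ spectrum ℂ (((S : X →ₗ[ℝ] X).restrict h).baseChange ℂ :
      Module.End ℂ (ℂ ⊗[ℝ] Y)), ∃ c : ℝ, 0 < c ∧ ∀ n, c * ‖z‖ ^ n ≤ ‖u n‖) :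
    restrictSpectralRadius S Y h ≤ liminf (fun n : ℕ => ‖u n‖ₑ ^ (1 / (n : ℝ))) atTop := by
  refine iSup₂_le fun z hz => ?_
  obtain ⟨c, hc, hcu⟩ := hu z hz
  have := ENNReal.le_liminf_of_mul_pow_le hc (norm_nonneg z) hcu
  simp only [ofReal_norm] at this
  exact this

end MinimalRank

/-! ### Irreducible semigroups: ranges and kernels of minimal rank operators. -/

section MainResult

variable {X : Type*} [NormedAddCommGroup X] [NormedSpace ℝ X]
  [Lattice X] [IsOrderedAddMonoid X] [IsOrderedModule ℝ X] [HasSolidNorm X]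
  {𝒮 : Subsemigroup (X →L[ℝ] X)}

theorem IsMinRank.exists_mul_mul_ne_zero (hpos : ∀ T ∈ 𝒮, IsPositiveOperator T)
    (hirr : IsIdealIrreducible (𝒮 : Set (X →L[ℝ] X)))
    {T : X →L[ℝ] X} (hT : IsMinRank (𝒮 : Set (X →L[ℝ] X)) T) : ∃ A ∈ 𝒮, T * A * T ≠ 0 := by
  by_contra! hc
  obtain ⟨y, hy, hy0⟩ := ContinuousLinearMap.exists_pos_apply_ne_zero hT.ne_zero
  exact hT.ne_zero (hirr.eq_zero_of_orbit hpos hT.mem hT.ne_zero (hpos T hT.mem).monotone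
    (hpos T hT.mem y hy) hy0 fun A hA => DFunLike.congr_fun (hc A hA) y)

theorem IsMinRank.exists_projection_range_eq (hpos : ∀ T ∈ 𝒮, IsPositiveOperator T)
    (hclosed : IsRPlusClosed (𝒮 : Set (X →L[ℝ] X)))
    (hirr : IsIdealIrreducible (𝒮 : Set (X →L[ℝ] X)))
    (hrank : minRank (𝒮 : Set (X →L[ℝ] X)) < ⊤)
    {T : X →L[ℝ] X} (hT : IsMinRank (𝒮 : Set (X →L[ℝ] X)) T) :
    ∃ P ∈ minRankProjections (𝒮 : Set (X →L[ℝ] X)),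
      LinearMap.range (P : X →ₗ[ℝ] X) = LinearMap.range (T : X →ₗ[ℝ] X) := by
  obtain ⟨A, hA, hne⟩ := hT.exists_mul_mul_ne_zero hpos hirr
  have hTA : T * A ≠ 0 := fun h => hne (by rw [h, zero_mul])
  have hmem := 𝒮.mul_mem hT.mem hA
  have hr := hT.range_mul hrank hmem hTA
  -- `T * A` has the same range as `T`, so if its square vanished it would kill the range of `T`,
  -- giving `T * A * T = 0`.
  obtain ⟨P, hP, hPr, -⟩ := (hT.mul_right hmem hTA).exists_projection hclosed hrank fun h => by
    refine hne (ContinuousLinearMap.ext fun x => ?_)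
    obtain ⟨w, hw⟩ := hr.ge (LinearMap.mem_range_self (T : X →ₗ[ℝ] X) x)
    change (T * A) w = T x at hw
    change (T * A) (T x) = 0
    rw [← hw]
    exact DFunLike.congr_fun h w
  exact ⟨P, hP, hPr.trans hr⟩

theorem IsMinRank.exists_projection_ker_eq (hpos : ∀ T ∈ 𝒮, IsPositiveOperator T)
    (hclosed : IsRPlusClosed (𝒮 : Set (X →L[ℝ] X)))
    (hirr : IsIdealIrreducible (𝒮 : Set (X →L[ℝ] X)))
    (hrank : minRank (𝒮 : Set (X →L[ℝ] X)) < ⊤)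
    {T : X →L[ℝ] X} (hT : IsMinRank (𝒮 : Set (X →L[ℝ] X)) T) :
    ∃ P ∈ minRankProjections (𝒮 : Set (X →L[ℝ] X)), ∀ x, P x = 0 ↔ T x = 0 := by
  obtain ⟨A, hA, hne⟩ := hT.exists_mul_mul_ne_zero hpos hirr
  have hAT : A * T ≠ 0 := fun h => hne (by rw [mul_assoc, h, mul_zero])
  have hmem := 𝒮.mul_mem hA hT.mem
  have hk : ∀ x, A (T x) = 0 → T x = 0 := fun x =>
    hT.apply_eq_zero_of_mul_left hrank hmem hAT
  -- If the square of `A * T` vanished, injectivity of `A` on the range of `T` would give `T * A * T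
  -- = 0`.
  obtain ⟨P, hP, -, hPk⟩ := (hT.mul_left hmem hAT).exists_projection hclosed hrank fun h =>
    hne (ContinuousLinearMap.ext fun x => hk _ (DFunLike.congr_fun h x))
  refine ⟨P, hP, fun x => (hPk x).trans ⟨hk x, fun h => ?_⟩⟩
  change A (T x) = 0
  rw [h, map_zero]

/-- If all projections of minimal rank have range `Y`, every non-zero member maps `Y` onto `Y`. -/
theorem map_range_eq_of_forall_range_eq (hpos : ∀ T ∈ 𝒮, IsPositiveOperator T)
    (hclosed : IsRPlusClosed (𝒮 : Set (X →L[ℝ] X)))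
    (hirr : IsIdealIrreducible (𝒮 : Set (X →L[ℝ] X)))
    (hrank : minRank (𝒮 : Set (X →L[ℝ] X)) < ⊤) {P : X →L[ℝ] X}
    (hP : IsMinRank (𝒮 : Set (X →L[ℝ] X)) P)
    (hY : ∀ Q ∈ minRankProjections (𝒮 : Set (X →L[ℝ] X)),
      LinearMap.range (Q : X →ₗ[ℝ] X) = LinearMap.range (P : X →ₗ[ℝ] X))
    {S : X →L[ℝ] X} (hS : S ∈ 𝒮) (hS0 : S ≠ 0) :
    LinearMap.range ((S * P : X →L[ℝ] X) : X →ₗ[ℝ] X) = LinearMap.range (P : X →ₗ[ℝ] X) := by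
  have hrange : ∀ A ∈ 𝒮, A * P ≠ 0 →
      LinearMap.range ((A * P : X →L[ℝ] X) : X →ₗ[ℝ] X) = LinearMap.range (P : X →ₗ[ℝ] X) := by
    intro A hA h0
    obtain ⟨Q, hQ, hQr⟩ := (hP.mul_left (𝒮.mul_mem hA hP.mem) h0).exists_projection_range_eq
      hpos hclosed hirr hrank
    rw [← hQr, hY Q hQ]
  refine hrange S hS fun hSP => hS0 ?_
  obtain ⟨y, hy, hy0⟩ := ContinuousLinearMap.exists_pos_apply_ne_zero hP.ne_zero
  refine hirr.eq_zero_of_orbit hpos hP.mem hP.ne_zero (hpos S hS).monotone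
    (hpos P hP.mem y hy) hy0 fun A hA => ?_
  -- The orbit of `P y` stays in the range of `P`, which `S` would annihilate.
  by_cases h0 : A * P = 0
  · have : A (P y) = 0 := DFunLike.congr_fun h0 y
    rw [this, map_zero]
  · obtain ⟨w, hw⟩ := (hrange A hA h0).le (LinearMap.mem_range_self _ y)
    change P w = A (P y) at hw
    rw [← hw]
    exact DFunLike.congr_fun hSP w

end MainResult

/-! ### The two growth estimates. -/

theorem mainTheorem7 {X : Type*} [NormedAddCommGroup X] [NormedSpace ℝ X] [CompleteSpace X]
    [Lattice X] [IsOrderedAddMonoid X] [IsOrderedModule ℝ X] [HasSolidNorm X]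
    (𝒮 : Subsemigroup (X →L[ℝ] X))
    (hpos : ∀ T ∈ 𝒮, IsPositiveOperator T)
    (hclosed : IsRPlusClosed (𝒮 : Set (X →L[ℝ] X)))
    (hirr : IsIdealIrreducible (𝒮 : Set (X →L[ℝ] X)))
    (hrank : minRank (𝒮 : Set (X →L[ℝ] X)) < ⊤) :
    -- the unique projection case
    (∀ P : X →L[ℝ] X, minRankProjections (𝒮 : Set (X →L[ℝ] X)) = {P} →
      ∀ S ∈ 𝒮, S ≠ 0 →
        ∃ hS : ∀ y ∈ LinearMap.range (P : X →ₗ[ℝ] X), S y ∈ LinearMap.range (P : X →ₗ[ℝ] X),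
          0 < restrictSpectralRadius S (LinearMap.range (P : X →ₗ[ℝ] X)) hS ∧
          (∀ x : X, 0 < x →
            restrictSpectralRadius S (LinearMap.range (P : X →ₗ[ℝ] X)) hS ≤
              liminf (fun n : ℕ => ‖(S ^ n) x‖ₑ ^ (1 / (n : ℝ))) atTop) ∧
          (∀ x : X, 0 < x → 0 < S x)) ∧
    -- the same range case, for the adjoint operators
    (∀ Y : Submodule ℝ X,
      (∀ P ∈ minRankProjections (𝒮 : Set (X →L[ℝ] X)),
        LinearMap.range (P : X →ₗ[ℝ] X) = Y) →
      ∀ S ∈ 𝒮, S ≠ 0 →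
        ∃ hS : ∀ y ∈ Y, S y ∈ Y,
          0 < restrictSpectralRadius S Y hS ∧
          (∀ f : StrongDual ℝ X, IsPosFunctional f →
            restrictSpectralRadius S Y hS ≤
              liminf (fun n : ℕ => ‖(banachAdjoint S ^ n) f‖ₑ ^ (1 / (n : ℝ))) atTop) ∧
          (∀ f : StrongDual ℝ X, IsPosFunctional f → IsPosFunctional (banachAdjoint S f))) := by
  obtain ⟨T, hT⟩ := exists_isMinRank hrank
  constructor
  · intro P hPs S hS hS0
    have hPm : P ∈ minRankProjections (𝒮 : Set (X →L[ℝ] X)) := hPs ▸ Set.mem_singleton P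
    have huniq : ∀ Q ∈ minRankProjections (𝒮 : Set (X →L[ℝ] X)), Q = P := fun Q hQ => by
      rwa [hPs] at hQ
    have hP := hT.of_mem_minRankProjections hPm
    have hPP : ∀ x, P (P x) = P x := fun x => DFunLike.congr_fun hPm.2.1 x
    have hr := map_range_eq_of_forall_range_eq hpos hclosed hirr hrank hP
      (fun Q hQ => by rw [huniq Q hQ]) hS hS0
    have hinv : ∀ y ∈ LinearMap.range (P : X →ₗ[ℝ] X), S y ∈ LinearMap.range (P : X →ₗ[ℝ] X) := by
      rintro _ ⟨x, rfl⟩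
      exact hr.le (LinearMap.mem_range_self _ x)
    -- A non-zero `P * A` has minimal rank, so its kernel is that of a minimal projection,
    -- necessarily `P`.
    have hker : ∀ A ∈ 𝒮, ∀ x, P x = 0 → P (A x) = 0 := by
      intro A hA x hx
      by_cases h0 : P * A = 0
      · exact DFunLike.congr_fun h0 x
      · obtain ⟨Q, hQ, hQk⟩ := (hP.mul_right (𝒮.mul_mem hP.mem hA) h0).exists_projection_ker_eq
          hpos hclosed hirr hrank
        rw [huniq Q hQ] at hQk
        exact (hQk x).1 hx
    have hPpos : ∀ x, 0 < x → P x ≠ 0 := fun x hx h =>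
      hP.ne_zero (hirr.eq_zero_of_orbit hpos hP.mem hP.ne_zero (hpos P hP.mem).monotone hx.le hx.ne'
        fun A hA => hker A hA x h)
    -- Both the range and the kernel of `P` are `S`-invariant; split `x` as `P x + (x - P x)`.
    have hcomm : ∀ x, P (S x) = S (P x) := by
      intro x
      have h1 := hker S hS (x - P x) (by rw [map_sub, hPP, sub_self])
      rw [map_sub, map_sub, sub_eq_zero] at h1
      obtain ⟨w, hw⟩ := hinv (P x) (LinearMap.mem_range_self _ x)
      change P w = S (P x) at hw
      rw [h1, ← hw, hPP]
    have hcomm' : ∀ (n : ℕ) x, P ((S ^ n) x) = (S ^ n) (P x) := by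
      have hc : Commute P S := ContinuousLinearMap.ext hcomm
      exact fun n x => DFunLike.congr_fun (hc.pow_right n).eq x
    refine ⟨hinv, restrictSpectralRadius_pos hrank hP hr hinv, fun x hx => ?_, fun x hx => ?_⟩
    · refine restrictSpectralRadius_le_liminf hinv fun z hz => ?_
      obtain ⟨c, hc, hg⟩ := hP.exists_growth hclosed hrank hS hinv hz
      have hPx : 0 < ‖P x‖ := norm_pos_iff.2 (hPpos x hx)
      have hPn : 0 < ‖P‖ := norm_pos_iff.2 hP.ne_zero
      refine ⟨c * ‖P x‖ / ‖P‖, by positivity, fun n => ?_⟩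
      rw [div_mul_eq_mul_div, div_le_iff₀ hPn]
      calc c * ‖P x‖ * ‖z‖ ^ n = c * ‖z‖ ^ n * ‖P x‖ := by ring
        _ ≤ ‖(S ^ n) (P x)‖ := hg n _ (LinearMap.mem_range_self (P : X →ₗ[ℝ] X) x)
        _ = ‖P ((S ^ n) x)‖ := by rw [hcomm']
        _ ≤ ‖P‖ * ‖(S ^ n) x‖ := P.le_opNorm _
        _ = _ := mul_comm _ _
    · refine lt_of_le_of_ne (hpos S hS x hx.le) fun h => hPpos x hx ?_
      have hSP : S * P ≠ 0 := fun h0 => by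
        have := hP.nontrivial_range
        rw [h0, ContinuousLinearMap.toLinearMap_zero, LinearMap.range_zero] at hr
        exact (Submodule.nontrivial_iff_ne_bot.1 this) hr.symm
      refine hP.apply_eq_zero_of_mul_left hrank (𝒮.mul_mem hS hP.mem) hSP ?_
      rw [← hcomm, ← h, map_zero]
  · intro Y hY S hS hS0
    -- The hypothesis on ranges alone does not provide a projection; irreducibility does.
    obtain ⟨P, hPm, -⟩ := hT.exists_projection_range_eq hpos hclosed hirr hrank
    have hP := hT.of_mem_minRankProjections hPm
    obtain rfl := hY P hPm
    have hr := fun A hA hA0 =>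
      map_range_eq_of_forall_range_eq hpos hclosed hirr hrank hP hY (S := A) hA hA0
    have hinv : ∀ A ∈ 𝒮, ∀ y ∈ LinearMap.range (P : X →ₗ[ℝ] X),
        A y ∈ LinearMap.range (P : X →ₗ[ℝ] X) := by
      rintro A hA _ ⟨x, rfl⟩
      by_cases hA0 : A = 0
      · rw [hA0]
        exact Submodule.zero_mem _
      · exact (hr A hA hA0).le (LinearMap.mem_range_self _ x)
    have hf : ∀ f : StrongDual ℝ X, IsPosFunctional f →
        ∃ y ∈ LinearMap.range (P : X →ₗ[ℝ] X), f y ≠ 0 := by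
      intro f hf
      by_contra! hc
      obtain ⟨x, hx, hx0⟩ := ContinuousLinearMap.exists_pos_apply_ne_zero hP.ne_zero
      exact hf.2 (hirr.eq_zero_of_orbit hpos hP.mem hP.ne_zero hf.monotone (hpos P hP.mem x hx) hx0
        fun A hA => hc _ (hinv A hA _ (LinearMap.mem_range_self (P : X →ₗ[ℝ] X) x)))
    refine ⟨hinv S hS, restrictSpectralRadius_pos hrank hP (hr S hS hS0) _, fun f hfp => ?_,
      fun f hfp => ⟨fun x hx => hfp.1 _ (hpos S hS x hx), fun h0 => ?_⟩⟩
    · refine restrictSpectralRadius_le_liminf _ fun z hz => ?_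
      obtain ⟨c, hc, hg⟩ := hP.exists_growth hclosed hrank hS _ hz
      obtain ⟨y, hy, hfy⟩ := hf f hfp
      have hfy' : 0 < ‖f y‖ := norm_pos_iff.2 hfy
      have hy' : 0 < ‖y‖ := norm_pos_iff.2 fun h => hfy (by rw [h, map_zero])
      -- With `S^n w = y`, combine `‖f y‖ ≤ ‖S*^n f‖ ‖w‖` and `c ‖z‖^n ‖w‖ ≤ ‖y‖` to eliminate `w`,
      -- which depends on `n`.
      refine ⟨c * ‖f y‖ / ‖y‖, by positivity, fun n => ?_⟩
      rw [div_mul_eq_mul_div, div_le_iff₀ hy']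
      obtain ⟨w, hw, hwy⟩ := surjOn_pow_of_range_eq (hr S hS hS0) n y hy
      have h1 := (banachAdjoint S ^ n) f |>.le_opNorm w
      rw [banachAdjoint_pow_apply, hwy] at h1
      have h2 := hg n w hw
      rw [hwy] at h2
      calc c * ‖f y‖ * ‖z‖ ^ n ≤ c * (‖(banachAdjoint S ^ n) f‖ * ‖w‖) * ‖z‖ ^ n := by gcongr
        _ = ‖(banachAdjoint S ^ n) f‖ * (c * ‖z‖ ^ n * ‖w‖) := by ring
        _ ≤ _ := by gcongr
    · obtain ⟨y, hy, hfy⟩ := hf f hfp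
      obtain ⟨w, -, hwy⟩ := surjOn_pow_of_range_eq (hr S hS hS0) 1 y hy
      rw [pow_one] at hwy
      exact hfy (by rw [← hwy]; exact DFunLike.congr_fun h0 w)
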